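/- **Theorem 5.2.** Let $\mathcal H$ be a complex Hilbert space with inner product $\langle\cdot,\cdot\rangle$ (for instance $L^2[(a,b),w]$). All powers of unbounded operators are taken on their natural domains, $\mathcal D(A^n)=\{f : f,Af,\dots,A^{n-1}f\in\mathcal D(A)\}$. Let $L_{\min}$ be a densely defined, closed, symmetric operator in $\mathcal H$ with finite deficiency indices $(m,m)$, i.e. $\dim\ker(L_{\min}^*-i)=\dim\ker(L_{\min}^*+i)=m$, and put $L_{\max}:=L_{\min}^*$ (for instance, the minimal and the maximal operator of a Sturm–Liouville expression $\ell$). Let $L$ be a self-adjoint extension of $L_{\min}$ that is bounded below, and suppose that $L$ has eigenfunctions $P_k\in\mathcal D(L)$, $k=0,1,2,\dots$, which are nonzero, pairwise orthogonal and complete in $\mathcal H$ (their linear span is dense). Let $n\ge 1$ be an integer. Then: 1. $L_{\min}^n$ is densely defined, closed and symmetric, $(L_{\min}^n)^*=L_{\max}^n$, and $L^n$ is a self-adjoint extension of $L_{\min}^n$. 2. $L_{\min}^n$ has deficiency indices $(nm,nm)$. 3. For all real $c$ and all $k>0$ such that $\langle (L+c)x,x\rangle\ge k\langle x,x\rangle$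 for every $x\in\mathcal D(L)$, the underlying vector space $\mathcal D((L+c)^n)$ of the $2n$-th left-definite space associated with $L+c$ is $\mathcal D(L^n)$. 4. There are $nm$ distinct indices $k_1,\dots,k_{nm}$ such that $P_{k_1},\dots,P_{k_{nm}}$ are GKN conditions for this space. That is, with $[f,g]_n:=\langle L_{\max}^nf,g\rangle-\langle f,L_{\max}^ng\rangle$ for $f,g\in\mathcal D(L_{\max}^n)$: the functions $P_{k_1},\dots,P_{k_{nm}}$ belong to $\mathcal D(L_{\max}^n)$, they are linearly independent modulo $\mathcal D(L_{\min}^n)$, they satisfy $[P_{k_i},P_{k_j}]_n=0$ for all $i,j$, and $$\mathcal D(L^n)=\{f\in\mathcal D(L_{\max}^n) : [f,P_{k_i}]_n=0\text{ for } i=1,\dots,nm\}.$$ -/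

import Mathlib

namespace LeftDefinite

noncomputable section

variable {H : Type*} [NormedAddCommGroup H] [InnerProductSpace ℂ H]

/-- Composition `A ∘ B` of unbounded operators on its natural domain
`{x ∈ D(B) | B x ∈ D(A)}`. -/
def opComp (A B : H →ₗ.[ℂ] H) : H →ₗ.[ℂ] H where
  domain :=
    { carrier := {x | ∃ h : x ∈ B.domain, B ⟨x, h⟩ ∈ A.domain}
      zero_mem' := ⟨B.domain.zero_mem, by
        have h0 : B ⟨0, B.domain.zero_mem⟩ = 0 := B.map_zero
        rw [h0]; exact A.domain.zero_mem⟩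
      add_mem' := by
        rintro x y ⟨hx, hx'⟩ ⟨hy, hy'⟩
        refine ⟨B.domain.add_mem hx hy, ?_⟩
        have h0 : B ⟨x + y, B.domain.add_mem hx hy⟩ = B ⟨x, hx⟩ + B ⟨y, hy⟩ :=
          B.map_add ⟨x, hx⟩ ⟨y, hy⟩
        rw [h0]; exact A.domain.add_mem hx' hy'
      smul_mem' := by
        rintro c x ⟨hx, hx'⟩
        refine ⟨B.domain.smul_mem c hx, ?_⟩
        have h0 : B ⟨c • x, B.domain.smul_mem c hx⟩ = c • B ⟨x, hx⟩ :=
          B.map_smul c ⟨x, hx⟩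
        rw [h0]; exact A.domain.smul_mem c hx' }
  toFun :=
    { toFun := fun x => A ⟨B ⟨x.1, x.2.choose⟩, x.2.choose_spec⟩
      map_add' := fun x y => by
        rw [← A.map_add]
        congr 1
        exact Subtype.ext (B.map_add ⟨x.1, x.2.choose⟩ ⟨y.1, y.2.choose⟩)
      map_smul' := fun c x => by
        rw [RingHom.id_apply, ← A.map_smul]
        congr 1
        exact Subtype.ext (B.map_smul c ⟨x.1, x.2.choose⟩) }

/-- The power `A ^ n` of an unbounded operator, by repeated composition on natural domains:
`D(A ^ n) = {x | x, A x, …, A ^ (n - 1) x ∈ D(A)}`, and `A ^ 0` is the identity of `H`. -/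
def opPow (A : H →ₗ.[ℂ] H) : ℕ → (H →ₗ.[ℂ] H)
  | 0 => LinearMap.id.toPMap ⊤
  | n + 1 => opComp A (opPow A n)

/-- The shifted operator `A + c I`, on the domain of `A`. -/
def opShift (A : H →ₗ.[ℂ] H) (c : ℝ) : H →ₗ.[ℂ] H :=
  ((c : ℂ) • (LinearMap.id : H →ₗ[ℂ] H)) +ᵥ A

/-- `A` is bounded below by `k`: `⟨A x, x⟩ ≥ k ⟨x, x⟩` for all `x ∈ D(A)`. -/
def IsBoundedBelowBy (A : H →ₗ.[ℂ] H) (k : ℝ) : Prop :=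
  ∀ x : A.domain, k * ‖(x : H)‖ ^ 2 ≤ RCLike.re (inner ℂ (x : H) (A x))

/-- `A` is a densely defined, symmetric and closed operator. -/
structure IsClosedSymmetric (A : H →ₗ.[ℂ] H) : Prop where
  dense : Dense (A.domain : Set H)
  symmetric : ∀ x y : A.domain, inner ℂ (A x) (y : H) = inner ℂ (x : H) (A y)
  closed : A.IsClosed

/-- `P 0, P 1, …` is a complete orthogonal system of eigenfunctions of `A`: nonzero, pairwise
orthogonal eigenvectors lying in `D(A)`, with dense linear span in `H`. -/
structure IsCompleteOrthogonalEigensystem (A : H →ₗ.[ℂ] H) (P : ℕ → H) : Prop where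
  ne_zero : ∀ k, P k ≠ 0
  eigen : ∀ k, ∃ (h : P k ∈ A.domain) (μ : ℂ), A ⟨P k, h⟩ = μ • P k
  orthogonal : ∀ j k, j ≠ k → inner ℂ (P j) (P k) = 0
  complete : Dense (Submodule.span ℂ (Set.range P) : Set H)

/-- The underlying vector space `V_{2n} = D(A ^ (2n / 2)) = D(A ^ n)` of the `2n`-th left-definite
space associated with a self-adjoint operator `A` that is bounded below by some `k > 0`
(its inner product is `⟨x, y⟩_{2n} = ⟨A ^ n x, A ^ n y⟩`). -/
def evenLeftDefiniteSpace (A : H →ₗ.[ℂ] H) (n : ℕ) : Submodule ℂ H :=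
  (opPow A n).domain

/-- `w 0, …, w (N - 1)` are linearly independent modulo the subspace `V`. -/
def LinIndepModulo (V : Submodule ℂ H) {N : ℕ} (w : Fin N → H) : Prop :=
  ∀ α : Fin N → ℂ, ∑ i, α i • w i ∈ V → ∀ i, α i = 0

/-- The sesquilinear form of an operator `M` (to be used for a maximal operator):
`[f, g] = ⟨M f, g⟩ - ⟨f, M g⟩`, linear in `f` and conjugate linear in `g`. Mathlib's `inner ℂ x y`
is linear in `y`, so `⟨x, y⟩` is `inner ℂ y x`. -/
def boundaryForm (M : H →ₗ.[ℂ] H) (f g : M.domain) : ℂ :=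
  inner ℂ (g : H) (M f) - inner ℂ (M g) (f : H)

variable [CompleteSpace H]

/-- The defect space `{f ∈ D(A*) | A* f = z f}`. -/
def defectSpace (A : H →ₗ.[ℂ] H) (z : ℂ) : Submodule ℂ H where
  carrier := {f | ∃ h : f ∈ A.adjoint.domain, A.adjoint ⟨f, h⟩ = z • f}
  zero_mem' := ⟨A.adjoint.domain.zero_mem, by
    rw [smul_zero]; exact A.adjoint.map_zero⟩
  add_mem' := by
    rintro x y ⟨hx, hx'⟩ ⟨hy, hy'⟩
    refine ⟨A.adjoint.domain.add_mem hx hy, ?_⟩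
    rw [smul_add, ← hx', ← hy']
    exact A.adjoint.map_add ⟨x, hx⟩ ⟨y, hy⟩
  smul_mem' := by
    rintro c x ⟨hx, hx'⟩
    refine ⟨A.adjoint.domain.smul_mem c hx, ?_⟩
    rw [smul_comm, ← hx']
    exact A.adjoint.map_smul c ⟨x, hx⟩

/-- `A` has the (finite) deficiency indices `(p, q)`: the dimensions of the positive and of the
negative defect space. -/
def HasDeficiencyIndices (A : H →ₗ.[ℂ] H) (p q : ℕ) : Prop :=
  Module.rank ℂ (defectSpace A Complex.I) = p ∧
    Module.rank ℂ (defectSpace A (-Complex.I)) = q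

/-- The functions `w 0, …, w (N - 1)` are GKN conditions for the subspace `D`, with respect to
the minimal operator `S` and its maximal operator `S*`: they belong to the maximal domain, are
linearly independent modulo the minimal domain, satisfy the Glazman symmetry conditions
`[w j, w k] = 0`, and `D` consists exactly of the `f` in the maximal domain with
`[f, w k] = 0` for all `k`. -/
structure IsGKNConditions (S : H →ₗ.[ℂ] H) (D : Submodule ℂ H) {N : ℕ} (w : Fin N → H) :
    Prop where
  mem_max : ∀ k, w k ∈ S.adjoint.domain
  linIndep : LinIndepModulo S.domain w
  glazman : ∀ j k, boundaryForm S.adjoint ⟨w j, mem_max j⟩ ⟨w k, mem_max k⟩ = 0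
  mem_iff : ∀ f : H, f ∈ D ↔ ∃ hf : f ∈ S.adjoint.domain,
    ∀ k, boundaryForm S.adjoint ⟨f, hf⟩ ⟨w k, mem_max k⟩ = 0

end

end LeftDefinite


/-!
Every operator involved is a restriction of one linear map `T`, and for nonreal `z₁, …, zₙ` the
operator `Tⁿ - w = (T - z₁) ⋯ (T - zₙ)` is built from factors whose ranges are known: a shift of the
maximal operator is surjective, since the shift of the self-adjoint `L` already is, and the range of
a shift of the minimal operator is the orthogonal complement of a finite-dimensional defect space.
Under such range conditions the adjoint of a composition is the composition of the adjoints, and the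
dimensions of the kernels of surjective factors add up. This gives `(L_minⁿ)* = L_maxⁿ`, the
self-adjointness of `Lⁿ` and the deficiency indices.

For the GKN conditions, `D(Lⁿ) / D(L_minⁿ)` has dimension `nm`, and it is spanned by the classes of
the eigenfunctions: `Lⁿ - i` is injective and maps `D(L_minⁿ)` plus the span of the `P_k` onto a
subspace which is dense, because it contains every `P_k`, and closed, because it contains a closed
subspace of finite codimension. It remains to select `nm` eigenfunctions that form a basis of the
quotient; any such basis consists of GKN conditions.
-/

namespace LeftDefinite

open Polynomial

section PowDom

variable {R M : Type*} [CommRing R] [AddCommGroup M] [Module R M]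

/-- The natural domain of the `n`-th power of the restriction of `T` to the subspace `V`. -/
def powDom (T : Module.End R M) (V : Submodule R M) (n : ℕ) : Submodule R M where
  carrier := {x | ∀ j < n, (T ^ j) x ∈ V}
  zero_mem' j _ := by simp only [map_zero, zero_mem]
  add_mem' hx hy j hj := by
    rw [map_add]
    exact V.add_mem (hx j hj) (hy j hj)
  smul_mem' c x hx j hj := by
    rw [map_smul]
    exact V.smul_mem c (hx j hj)

variable (T : Module.End R M) {V W : Submodule R M} {n : ℕ} {x : M}

lemma powDom_mono (h : V ≤ W) (n : ℕ) : powDom T V n ≤ powDom T W n :=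
  fun _ hx j hj => h (hx j hj)

@[simp]
lemma powDom_zero (V : Submodule R M) : powDom T V 0 = ⊤ :=
  eq_top_iff.mpr fun _ _ j hj => absurd hj j.not_lt_zero

@[simp]
lemma powDom_one (V : Submodule R M) : powDom T V 1 = V :=
  le_antisymm (fun _ hx => hx 0 one_pos) fun x hx j hj => by
    rwa [Nat.lt_one_iff.mp hj, pow_zero, Module.End.one_apply]

lemma mem_powDom_succ : x ∈ powDom T V (n + 1) ↔ x ∈ powDom T V n ∧ (T ^ n) x ∈ V :=
  Nat.forall_lt_succ_right

lemma mem_powDom_iff_aeval :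
    x ∈ powDom T V n ↔ ∀ p : R[X], p.degree < n → aeval T p x ∈ V := by
  refine ⟨fun hx p hp => ?_, fun h j hj => ?_⟩
  · rw [aeval_endomorphism]
    exact V.sum_mem fun j hj =>
      V.smul_mem _ (hx j (Nat.cast_lt.mp ((le_degree_of_mem_supp j hj).trans_lt hp)))
  · simpa only [map_pow, aeval_X] using
      h (X ^ j) ((degree_X_pow_le j).trans_lt (Nat.cast_lt.mpr hj))

lemma mem_powDom_add_natDegree [Nontrivial R] {q : R[X]} (hq : q.Monic) :
    x ∈ powDom T V (n + q.natDegree) ↔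
      x ∈ powDom T V q.natDegree ∧ aeval T q x ∈ powDom T V n := by
  have hdeg : q.degree = q.natDegree := degree_eq_natDegree hq.ne_zero
  simp only [mem_powDom_iff_aeval, ← Module.End.mul_apply, ← map_mul]
  refine ⟨fun h => ⟨fun p hp => h p (hp.trans_le ?_), fun p hp => h (p * q) ?_⟩,
    fun ⟨hrem, hquot⟩ p hp => ?_⟩
  · exact Nat.cast_le.mpr (Nat.le_add_left _ _)
  · rw [hq.degree_mul, hdeg, Nat.cast_add]
    exact WithBot.add_lt_add_right (WithBot.natCast_ne_bot _) hp
  · have hdivision : aeval T p x = aeval T (p %ₘ q) x + aeval T (p /ₘ q * q) x := by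
      rw [← LinearMap.add_apply, ← map_add, mul_comm, modByMonic_add_div]
    rw [hdivision]
    refine V.add_mem (hrem _ ?_) (hquot _ ?_)
    · exact hdeg ▸ degree_modByMonic_lt p hq
    · rcases lt_or_ge p.degree q.degree with hpq | hpq
      · rw [(divByMonic_eq_zero_iff hq).mpr hpq, degree_zero]
        exact WithBot.bot_lt_coe _
      · rw [← degree_add_divByMonic hq hpq, hdeg, Nat.cast_add, add_comm] at hp
        exact lt_of_add_lt_add_right hp

lemma aeval_X_sub_C_eq (z : R) : aeval T (X - C z) = T - z • 1 := by
  rw [map_sub, aeval_X, aeval_C, Algebra.algebraMap_eq_smul_one]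

lemma powDom_succ_eq_inf_comap_sub [Nontrivial R] (V : Submodule R M) (n : ℕ) (z : R) :
    powDom T V (n + 1) = V ⊓ (powDom T V n).comap (T - z • 1) := by
  ext x
  simpa only [natDegree_X_sub_C, aeval_X_sub_C_eq, powDom_one, Submodule.mem_inf,
    Submodule.mem_comap] using
    mem_powDom_add_natDegree (V := V) (n := n) (x := x) T (monic_X_sub_C z)

lemma powDom_natDegree_succ [Nontrivial R] (V : Submodule R M) {q : R[X]} (hq : q.Monic) :
    powDom T V (q.natDegree + 1) = powDom T V q.natDegree ⊓ V.comap (aeval T q) := by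
  ext x
  simpa only [powDom_one, add_comm, Submodule.mem_inf, Submodule.mem_comap] using
    mem_powDom_add_natDegree (V := V) (n := 1) (x := x) T hq

lemma pow_apply_eq_pow_smul {μ : R} (h : T x = μ • x) (j : ℕ) : (T ^ j) x = μ ^ j • x := by
  induction j with
  | zero => simp only [pow_zero, Module.End.one_apply, one_smul]
  | succ j ih => rw [pow_succ', Module.End.mul_apply, ih, map_smul, h, smul_smul, pow_succ]

lemma powDom_sub_smul_one (V : Submodule R M) (n : ℕ) (z : R) :
    powDom (T - z • 1) V n = powDom T V n := by
  have hle (S : Module.End R M) (w : R) : powDom S V n ≤ powDom (S - w • 1) V n := by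
    intro x hx j hj
    rw [← aeval_X_sub_C_eq, ← map_pow]
    refine (mem_powDom_iff_aeval S).mp hx _ (lt_of_le_of_lt ?_ (Nat.cast_lt.mpr hj))
    simpa using degree_pow_le_of_le j (degree_X_sub_C_le w)
  refine le_antisymm ?_ (hle T z)
  simpa only [neg_smul, sub_neg_eq_add, sub_add_cancel] using hle (T - z • 1) (-z)

end PowDom

section Rank

universe u

variable {K : Type*} {M N P : Type u} [Field K] [AddCommGroup M] [Module K M]
  [AddCommGroup N] [Module K N] [AddCommGroup P] [Module K P]

lemma rank_map_add_rank_inf_ker (f : M →ₗ[K] N) (V : Submodule K M) :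
    Module.rank K (V.map f) + Module.rank K ↥(V ⊓ f.ker) = Module.rank K V := by
  rw [← (f.domRestrict V).rank_range_add_rank_ker, LinearMap.range_domRestrict,
    LinearMap.ker_domRestrict, ← Submodule.map_comap_subtype]
  exact congrArg _
    (LinearEquiv.rank_eq (Submodule.equivMapOfInjective _ V.injective_subtype _)).symm

lemma rank_map_eq_of_inf_ker_eq {f : M →ₗ[K] N} {g : M →ₗ[K] P} {V : Submodule K M}
    (h : V ⊓ f.ker = V ⊓ g.ker) : Module.rank K (V.map f) = Module.rank K (V.map g) := by
  have hker : (f.domRestrict V).ker = (g.domRestrict V).ker :=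
    Submodule.map_injective_of_injective V.injective_subtype (by
      simpa only [LinearMap.ker_domRestrict, Submodule.map_comap_subtype] using h)
  rw [← LinearMap.range_domRestrict, ← LinearMap.range_domRestrict]
  exact (((f.domRestrict V).quotKerEquivRange.symm.trans (Submodule.quotEquivOfEq _ _ hker)).trans
    (g.domRestrict V).quotKerEquivRange).rank_eq

lemma rank_inf_ker_comp (A : M →ₗ[K] N) (B : N →ₗ[K] P) {V : Submodule K M} {U : Submodule K N}
    (h : U ⊓ B.ker ≤ V.map A) :
    Module.rank K ↥(V ⊓ U.comap A ⊓ (B ∘ₗ A).ker) =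
      Module.rank K ↥(U ⊓ B.ker) + Module.rank K ↥(V ⊓ A.ker) := by
  have hpreimage : V ⊓ U.comap A ⊓ (B ∘ₗ A).ker = V ⊓ (U ⊓ B.ker).comap A := by
    rw [LinearMap.ker_comp, inf_assoc, ← Submodule.comap_inf]
  have hker : A.ker ≤ (U ⊓ B.ker).comap A := LinearMap.ker_le_comap _
  rw [hpreimage, ← rank_map_add_rank_inf_ker A, ← Submodule.map_inf_eq_map_inf_comap,
    inf_eq_right.mpr h, inf_assoc, inf_eq_right.mpr hker]

lemma rank_powDom_inf_ker_aeval (T : Module.End K M) {W : Submodule K M} {m : Cardinal.{u}}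
    (s : Multiset K) (hsurj : ∀ z ∈ s, W.map (T - z • 1) = ⊤)
    (hrank : ∀ z ∈ s, Module.rank K ↥(W ⊓ (T - z • 1).ker) = m) :
    Module.rank K ↥(powDom T W s.card ⊓ (aeval T (s.map (X - C ·)).prod).ker) = s.card * m := by
  induction s using Multiset.induction with
  | empty =>
    rw [Multiset.map_zero, Multiset.prod_zero, map_one, Module.End.one_eq_id, LinearMap.ker_id,
      inf_bot_eq, rank_bot, Multiset.card_zero, Nat.cast_zero, zero_mul]
  | cons z s ih =>
    simp only [Multiset.forall_mem_cons] at hsurj hrank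
    have hker : powDom T W s.card ⊓ (aeval T (s.map (X - C ·)).prod).ker ≤ W.map (T - z • 1) :=
      hsurj.1 ▸ le_top
    rw [Multiset.map_cons, Multiset.prod_cons, mul_comm, map_mul, aeval_X_sub_C_eq,
      Multiset.card_cons, powDom_succ_eq_inf_comap_sub T W _ z, Module.End.mul_eq_comp,
      rank_inf_ker_comp _ _ hker, ih hsurj.2 hrank.2, hrank.1, Nat.cast_succ, add_one_mul]

lemma rank_map_mkQ_sup_of_disjoint {V E : Submodule K M} (h : Disjoint V E) :
    Module.rank K ((V ⊔ E).map V.mkQ) = Module.rank K E := by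
  rw [Submodule.map_sup, Submodule.mkQ_map_self, bot_sup_eq, ← rank_map_add_rank_inf_ker V.mkQ E,
    Submodule.ker_mkQ, inf_comm, h.eq_bot, rank_bot, add_zero]

lemma eq_of_map_le_of_disjoint_ker {f : M →ₗ[K] N} {X L : Submodule K M} (hXL : X ≤ L)
    (hdisj : Disjoint L f.ker) (h : L.map f ≤ X.map f) : X = L := by
  have hL : L ≤ X ⊔ f.ker := (LinearMap.map_le_map_iff f).mp h
  calc X = (X ⊔ f.ker) ⊓ L := by
        rw [sup_inf_assoc_of_le _ hXL, inf_comm, hdisj.eq_bot, sup_bot_eq]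
    _ = L := inf_eq_right.mpr hL

lemma exists_fin_linearIndependent_span_eq {ι : Type*} {v : ι → M} {n : ℕ}
    (h : Module.rank K (Submodule.span K (Set.range v)) = n) :
    ∃ κ : Fin n → ι, Function.Injective κ ∧ LinearIndependent K (v ∘ κ) ∧
      Submodule.span K (Set.range (v ∘ κ)) = Submodule.span K (Set.range v) := by
  obtain ⟨ι', κ, hκ, hspan, hli⟩ := exists_linearIndependent' K v
  rw [← hspan] at h
  have hfin : Module.Finite K (Submodule.span K (Set.range (v ∘ κ))) :=
    Module.rank_lt_aleph0_iff.mp (h ▸ Cardinal.natCast_lt_aleph0)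
  have : Finite ι' := Module.Finite.finite_basis (Module.Basis.span hli)
  let e : Fin n ≃ ι' := (Finite.equivFinOfCardEq <| by
    rw [← Module.finrank_eq_nat_card_basis (Module.Basis.span hli),
      Module.finrank_eq_of_rank_eq h]).symm
  refine ⟨κ ∘ e, hκ.comp e.injective, hli.comp e e.injective, ?_⟩
  rw [← hspan, ← Function.comp_assoc, e.surjective.range_comp]

lemma exists_fin_linearIndependent_mkQ {ι : Type*} {V : Submodule K M} {P : ι → M} {n : ℕ}
    (h : Module.rank K ((V ⊔ Submodule.span K (Set.range P)).map V.mkQ) = n) :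
    ∃ κ : Fin n → ι, Function.Injective κ ∧ LinearIndependent K (V.mkQ ∘ P ∘ κ) ∧
      V ⊔ Submodule.span K (Set.range (P ∘ κ)) = V ⊔ Submodule.span K (Set.range P) := by
  rw [Submodule.map_sup, Submodule.mkQ_map_self, bot_sup_eq, Submodule.map_span,
    ← Set.range_comp] at h
  obtain ⟨κ, hκ, hli, hspan⟩ := exists_fin_linearIndependent_span_eq h
  refine ⟨κ, hκ, hli, ?_⟩
  rw [← Submodule.comap_map_mkQ, ← Submodule.comap_map_mkQ, Submodule.map_span,
    Submodule.map_span, ← Set.range_comp, ← Set.range_comp]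
  exact congrArg _ hspan

end Rank

section Adjoint

open InnerProductSpace

variable {𝕜 E F G : Type*} [RCLike 𝕜]
  [NormedAddCommGroup E] [InnerProductSpace 𝕜 E] [NormedAddCommGroup F] [InnerProductSpace 𝕜 F]
  [NormedAddCommGroup G] [InnerProductSpace 𝕜 G]

/-- The unbounded operator `B|W` is the adjoint of the unbounded operator `A|V`, and the latter is
densely defined (take `φ = 0` in the definition). -/
def IsAdjointOn (A : E →ₗ[𝕜] F) (V : Submodule 𝕜 E) (B : F →ₗ[𝕜] E) (W : Submodule 𝕜 F) : Prop :=
  ∀ φ g, (∀ y ∈ V, ⟪φ, A y⟫_𝕜 = ⟪g, y⟫_𝕜) ↔ φ ∈ W ∧ B φ = g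

namespace IsAdjointOn

variable {A : E →ₗ[𝕜] F} {V : Submodule 𝕜 E} {B : F →ₗ[𝕜] E} {W : Submodule 𝕜 F}

lemma inner_eq (h : IsAdjointOn A V B W) {φ : F} (hφ : φ ∈ W) {y : E} (hy : y ∈ V) :
    ⟪φ, A y⟫_𝕜 = ⟪B φ, y⟫_𝕜 :=
  (h φ (B φ)).mpr ⟨hφ, rfl⟩ y hy

lemma dense [CompleteSpace E] (h : IsAdjointOn A V B W) : Dense (V : Set E) := by
  rw [Submodule.dense_iff_topologicalClosure_eq_top, Submodule.topologicalClosure_eq_top_iff,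
    eq_bot_iff]
  intro g hg
  have h0 : B 0 = g := ((h 0 g).mp fun y hy => by
    rw [inner_zero_left, (V.mem_orthogonal' g).mp hg y hy]).2
  rw [← h0, map_zero, Submodule.mem_bot]

end IsAdjointOn

lemma IsAdjointOn.sub_smul_one {A B : Module.End 𝕜 E} {V W : Submodule 𝕜 E}
    (h : IsAdjointOn A V B W) (z : 𝕜) :
    IsAdjointOn (A - z • 1) V (B - (starRingEnd 𝕜) z • 1) W := by
  intro φ g
  refine (forall₂_congr fun y _ => ?_).trans
    ((h φ (g + (starRingEnd 𝕜) z • φ)).trans (and_congr_right fun _ => ?_))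
  · rw [LinearMap.sub_apply, LinearMap.smul_apply, Module.End.one_apply, inner_sub_right,
      inner_smul_right, inner_add_left, inner_smul_left, RCLike.conj_conj, sub_eq_iff_eq_add]
  · rw [LinearMap.sub_apply, LinearMap.smul_apply, Module.End.one_apply, sub_eq_iff_eq_add]

lemma exists_inner_eq_of_orthogonal_le_ker (f : E →ₗ[𝕜] 𝕜) (V K : Submodule 𝕜 E)
    [FiniteDimensional 𝕜 K] (hf : V ⊓ Kᗮ ≤ f.ker) : ∃ k ∈ K, ∀ x ∈ V, f x = ⟪k, x⟫_𝕜 := by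
  let p : V →ₗ[𝕜] K := K.orthogonalProjectionOnto.toLinearMap.domRestrict V
  obtain ⟨h, hh⟩ : f.domRestrict V ∈ p.dualMap.range := by
    rw [LinearMap.range_dualMap_eq_dualAnnihilator_ker, Submodule.mem_dualAnnihilator]
    exact fun x hx => hf ⟨x.2, Submodule.orthogonalProjectionOnto_eq_zero_iff.mp hx⟩
  refine ⟨((toDual 𝕜 K).symm h.toContinuousLinearMap : K), Subtype.mem _, fun x hx => ?_⟩
  rw [← Submodule.inner_orthogonalProjectionOnto_eq_of_mem_left, toDual_symm_apply]
  exact (LinearMap.congr_fun hh ⟨x, hx⟩).symm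

theorem IsAdjointOn.comp {A : E →ₗ[𝕜] F} {V : Submodule 𝕜 E} {Astar : F →ₗ[𝕜] E}
    {Vstar : Submodule 𝕜 F} {B : F →ₗ[𝕜] G} {U : Submodule 𝕜 F} {Bstar : G →ₗ[𝕜] F}
    {Ustar : Submodule 𝕜 G}
    (hA : IsAdjointOn A V Astar Vstar) (hB : IsAdjointOn B U Bstar Ustar)
    [FiniteDimensional 𝕜 ↥(Vstar ⊓ Astar.ker)] (hrange : (Vstar ⊓ Astar.ker)ᗮ ≤ V.map A)
    (hrange' : (V ⊓ A.ker)ᗮ ≤ Vstar.map Astar) :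
    IsAdjointOn (B ∘ₗ A) (V ⊓ U.comap A) (Astar ∘ₗ Bstar) (Ustar ⊓ Vstar.comap Bstar) := by
  -- Solve `Astar η = g`. Then `u ↦ ⟪φ, B u⟫ - ⟪η, u⟫` vanishes on `U` intersected with the range of
  -- `A`, so on `U` it is represented by some `k` in the kernel of `Astar`, and `Bstar φ = k + η`.
  refine fun φ g => ⟨fun h => ?_, ?_⟩
  · obtain ⟨η, hη, rfl⟩ : g ∈ Vstar.map Astar := hrange' <| (Submodule.mem_orthogonal' _ _).mpr
      fun y ⟨hyV, hy⟩ => by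
        have hyU : y ∈ U.comap A := LinearMap.ker_le_comap A hy
        rw [← h y ⟨hyV, hyU⟩, LinearMap.comp_apply, LinearMap.mem_ker.mp hy, map_zero,
          inner_zero_right]
    obtain ⟨k, ⟨hk, hAk⟩, hφ⟩ := exists_inner_eq_of_orthogonal_le_ker
      (innerₛₗ 𝕜 φ ∘ₗ B - innerₛₗ 𝕜 η) U (Vstar ⊓ Astar.ker) fun u ⟨huU, hu⟩ => by
        obtain ⟨y, hy, rfl⟩ := hrange hu
        exact sub_eq_zero.mpr ((h y ⟨hy, huU⟩).trans (hA.inner_eq hη hy).symm)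
    obtain ⟨hφU, hBφ⟩ := (hB φ (k + η)).mp fun u hu => by
      rw [inner_add_left]; exact sub_eq_iff_eq_add.mp (hφ u hu)
    refine ⟨⟨hφU, ?_⟩, ?_⟩
    · exact Submodule.mem_comap.mpr (hBφ ▸ Vstar.add_mem hk hη)
    · rw [LinearMap.comp_apply, hBφ, map_add, LinearMap.mem_ker.mp hAk, zero_add]
  · rintro ⟨⟨hφU, hφV⟩, rfl⟩ y ⟨hyV, hyU⟩
    exact (hB.inner_eq hφU hyU).trans (hA.inner_eq hφV hyV)

theorem IsAdjointOn.map_eq_top {A : E →ₗ[𝕜] F} {V : Submodule 𝕜 E} {B : F →ₗ[𝕜] E}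
    {W : Submodule 𝕜 F} [CompleteSpace F] (h : IsAdjointOn A V B W) {c : ℝ} (hc : 0 < c)
    (hA : ∀ x ∈ V, c * ‖x‖ ≤ ‖A x‖) : W.map B = ⊤ := by
  have hinj : (A.domRestrict V).ker = ⊥ := LinearMap.ker_eq_bot'.mpr fun x hx => by
    have hx0 : c * ‖(x : E)‖ ≤ 0 := (hA x x.2).trans_eq (norm_eq_zero.mpr hx)
    exact Subtype.ext (norm_le_zero_iff.mp (nonpos_of_mul_nonpos_right hx0 hc))
  let e := LinearEquiv.ofInjective (A.domRestrict V) (LinearMap.ker_eq_bot.mp hinj)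
  refine eq_top_iff.mpr fun g _ => ?_
  have hbound (y : (A.domRestrict V).range) : ‖⟪g, (e.symm y : E)⟫_𝕜‖ ≤ ‖g‖ / c * ‖y‖ := by
    have hy : c * ‖(e.symm y : E)‖ ≤ ‖(y : F)‖ :=
      (hA _ (e.symm y).2).trans_eq
        (congrArg (fun w : (A.domRestrict V).range => ‖w‖) (e.apply_symm_apply y))
    calc ‖⟪g, (e.symm y : E)⟫_𝕜‖ ≤ ‖g‖ * ‖(e.symm y : E)‖ := norm_inner_le_norm _ _
      _ ≤ ‖g‖ * (‖(y : F)‖ / c) := by gcongr; rwa [le_div_iff₀' hc]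
      _ = ‖g‖ / c * ‖y‖ := by rw [Submodule.coe_norm]; ring
  obtain ⟨f, hf, -⟩ := exists_extension_norm_eq _
    (((innerₛₗ 𝕜 g ∘ₗ V.subtype) ∘ₗ e.symm.toLinearMap).mkContinuous _ hbound)
  refine ⟨(toDual 𝕜 F).symm f, (h _ g).mp fun y hy => ?_⟩
  rw [toDual_symm_apply]
  calc f (A y) = ⟪g, (e.symm (e ⟨y, hy⟩) : E)⟫_𝕜 := hf (e ⟨y, hy⟩)
    _ = ⟪g, y⟫_𝕜 := by rw [e.symm_apply_apply]

end Adjoint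

section LinearPMap

variable {𝕜 E F : Type*} [RCLike 𝕜] [NormedAddCommGroup E] [InnerProductSpace 𝕜 E]
  [NormedAddCommGroup F] [InnerProductSpace 𝕜 F]
  {A : E →ₗ[𝕜] F} {V : Submodule 𝕜 E} {B : F →ₗ[𝕜] E} {W : Submodule 𝕜 F}

lemma isAdjointOn_iff [CompleteSpace E] :
    IsAdjointOn A V B W ↔ Dense (V : Set E) ∧ (A.toPMap V).adjoint = B.toPMap W := by
  refine ⟨fun h => ⟨h.dense, ?_⟩, fun ⟨hV, h⟩ φ g => ⟨fun hφ => ?_, ?_⟩⟩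
  · have hadj := LinearPMap.adjoint_isFormalAdjoint (T := A.toPMap V) h.dense
    have hmem (φ : (A.toPMap V).adjoint.domain) : (φ : F) ∈ W ∧ B φ = (A.toPMap V).adjoint φ :=
      (h φ _).mp fun y hy => (hadj φ ⟨y, hy⟩).symm
    refine LinearPMap.ext (le_antisymm (fun φ hφ => (hmem ⟨φ, hφ⟩).1) fun φ hφ => ?_)
      fun φ hφ _ => (hmem ⟨φ, hφ⟩).2.symm
    exact LinearPMap.mem_adjoint_domain_of_exists φ ⟨B φ, fun y => (h.inner_eq hφ y.2).symm⟩
  · have hadj := LinearPMap.adjoint_isFormalAdjoint (T := A.toPMap V) hV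
    have hmem : φ ∈ (A.toPMap V).adjoint.domain :=
      LinearPMap.mem_adjoint_domain_of_exists φ ⟨g, fun y => (hφ y y.2).symm⟩
    rw [h] at hadj hmem
    exact ⟨hmem, hV.eq_of_inner_left 𝕜 fun y hy => (hadj ⟨φ, hmem⟩ ⟨y, hy⟩).trans (hφ y hy)⟩
  · rintro ⟨hφ, rfl⟩ y hy
    have hadj := LinearPMap.adjoint_isFormalAdjoint (T := A.toPMap V) hV
    rw [h] at hadj
    exact (hadj ⟨φ, hφ⟩ ⟨y, hy⟩).symm

lemma adjoint_adjoint_le_of_isClosed [CompleteSpace E] [CompleteSpace F]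
    {g : Submodule 𝕜 (E × F)} (hg : IsClosed (g : Set (E × F))) : g.adjoint.adjoint ≤ g := by
  intro x hx
  let e := WithLp.linearEquiv 2 𝕜 (E × F)
  let g₂ : Submodule 𝕜 (WithLp 2 (E × F)) := g.comap e.toLinearMap
  have hg₂ : IsClosed (g₂ : Set (WithLp 2 (E × F))) :=
    hg.preimage (WithLp.prod_continuous_ofLp 2 E F)
  have : CompleteSpace g₂ := hg₂.completeSpace_coe
  suffices e.symm x ∈ g₂ᗮᗮ by rwa [g₂.orthogonal_orthogonal] at this
  refine (Submodule.mem_orthogonal _ _).mpr fun u hu => ?_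
  have hu' : (u.snd, -u.fst) ∈ g.adjoint := (g.mem_adjoint_iff _).mpr fun a b hab => by
    rw [inner_neg_right, sub_neg_eq_add, add_comm]
    exact hu (e.symm (a, b)) hab
  have hux := (g.adjoint.mem_adjoint_iff x).mp hx _ _ hu'
  rwa [inner_neg_left, ← neg_add', neg_eq_zero] at hux

/-- Von Neumann's `A** = A` for closed `A`. -/
lemma IsAdjointOn.symm_of_isClosed [CompleteSpace E] [CompleteSpace F] (h : IsAdjointOn A V B W)
    (hclosed : (A.toPMap V).IsClosed) : IsAdjointOn B W A V := by
  refine fun φ g => ⟨fun hφ => ?_, ?_⟩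
  · have hmem : (φ, g) ∈ (A.toPMap V).graph := by
      refine adjoint_adjoint_le_of_isClosed hclosed ((Submodule.mem_adjoint_iff _ _).mpr ?_)
      intro b a hba
      obtain ⟨hb, rfl⟩ := (h b a).mp fun y hy => by
        have hAy := sub_eq_zero.mp ((Submodule.mem_adjoint_iff _ _).mp hba y (A y)
          ((A.toPMap V).mem_graph ⟨y, hy⟩))
        rw [← inner_conj_symm, hAy, inner_conj_symm]
      rw [← inner_conj_symm, hφ b hb, inner_conj_symm, sub_self]
    obtain ⟨y, rfl, rfl⟩ := (LinearPMap.mem_graph_iff _).mp hmem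
    exact ⟨y.2, rfl⟩
  · rintro ⟨hφ, rfl⟩ y hy
    rw [← inner_conj_symm, ← h.inner_eq hy hφ, inner_conj_symm]

end LinearPMap

section OperatorPowers

variable {H : Type*} [NormedAddCommGroup H] [InnerProductSpace ℂ H]
  (T : Module.End ℂ H) {V W : Submodule ℂ H}

lemma opPow_toPMap (V : Submodule ℂ H) (n : ℕ) :
    opPow (T.toPMap V) n = (T ^ n).toPMap (powDom T V n) := by
  induction n with
  | zero => rw [powDom_zero, pow_zero]; rfl
  | succ n ih =>
    rw [opPow, ih]
    refine LinearPMap.ext ?_ fun x _ _ => ?_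
    · ext x
      exact exists_prop.trans (mem_powDom_succ T).symm
    · exact (LinearMap.congr_fun (pow_succ' T n) x).symm

lemma opShift_toPMap (V : Submodule ℂ H) (c : ℝ) :
    opShift (T.toPMap V) c = (T - (-(c : ℂ)) • 1).toPMap V :=
  LinearPMap.ext rfl fun x _ _ => by
    rw [neg_smul, sub_neg_eq_add, add_comm]
    rfl

lemma toPMap_mono (h : V ≤ W) : T.toPMap V ≤ T.toPMap W :=
  ⟨h, fun _ _ hxy => congrArg T hxy⟩

variable {T}

lemma exists_eq_toPMap (A : H →ₗ.[ℂ] H) : ∃ T : Module.End ℂ H, A = T.toPMap A.domain := by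
  obtain ⟨T, hT⟩ := LinearMap.exists_extend A.toFun
  exact ⟨T, LinearPMap.ext rfl fun x hx _ => (LinearMap.congr_fun hT ⟨x, hx⟩).symm⟩

lemma eq_toPMap_of_le {A : H →ₗ.[ℂ] H} (h : A ≤ T.toPMap W) : A = T.toPMap A.domain :=
  LinearPMap.ext rfl fun _ hx _ => h.2 (x := ⟨_, hx⟩) (y := ⟨_, h.1 hx⟩) rfl

variable [CompleteSpace H]

lemma defectSpace_toPMap (h : IsAdjointOn T V T W) (z : ℂ) :
    defectSpace (T.toPMap V) z = W ⊓ (T - z • 1).ker := by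
  ext x
  change (∃ hx : x ∈ (T.toPMap V).adjoint.domain, (T.toPMap V).adjoint ⟨x, hx⟩ = z • x) ↔ _
  rw [(isAdjointOn_iff.mp h).2]
  exact exists_prop.trans (and_congr_right' (sub_eq_zero (a := T x) (b := z • x)).symm)

end OperatorPowers

section SelfAdjointExtension

open ComplexConjugate InnerProductSpace

variable {H : Type*} [NormedAddCommGroup H] [InnerProductSpace ℂ H]
  {T : Module.End ℂ H} {V L W : Submodule ℂ H} {z : ℂ}

lemma im_I_ne_zero : Complex.I.im ≠ 0 := one_ne_zero

lemma im_conj_ne_zero (hz : z.im ≠ 0) : (conj z).im ≠ 0 := by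
  rwa [Complex.conj_im, neg_ne_zero]

lemma abs_im_mul_norm_le_norm_sub {x y : H} (h : (⟪x, y⟫_ℂ).im = 0) (z : ℂ) :
    |z.im| * ‖x‖ ≤ ‖y - z • x‖ := by
  rcases eq_or_ne x 0 with rfl | hx
  · simp only [norm_zero, mul_zero, norm_nonneg]
  have hself : ⟪x, x⟫_ℂ = ((‖x‖ ^ 2 : ℝ) : ℂ) := by
    rw [inner_self_eq_norm_sq_to_K, Complex.ofReal_pow]
    rfl
  refine le_of_mul_le_mul_left ?_ (norm_pos_iff.mpr hx)
  calc ‖x‖ * (|z.im| * ‖x‖) = |(⟪x, y - z • x⟫_ℂ).im| := by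
        rw [inner_sub_right, inner_smul_right, hself, Complex.sub_im, Complex.im_mul_ofReal, h,
          zero_sub, abs_neg, abs_mul, abs_of_nonneg (sq_nonneg ‖x‖)]
        ring
    _ ≤ ‖⟪x, y - z • x⟫_ℂ‖ := Complex.abs_im_le_norm _
    _ ≤ ‖x‖ * ‖y - z • x‖ := norm_inner_le_norm _ _

namespace IsAdjointOn

lemma abs_im_mul_norm_le (hL : IsAdjointOn T L T L) (z : ℂ) {x : H} (hx : x ∈ L) :
    |z.im| * ‖x‖ ≤ ‖(T - z • 1) x‖ :=
  abs_im_mul_norm_le_norm_sub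
    (Complex.conj_eq_iff_im.mp <| (inner_conj_symm _ _).trans (hL.inner_eq hx hx).symm) z

lemma disjoint_ker_sub (hL : IsAdjointOn T L T L) (hz : z.im ≠ 0) :
    Disjoint L (T - z • 1).ker :=
  LinearMap.disjoint_ker.mpr fun x hx hx0 => by
    have hle := hL.abs_im_mul_norm_le z hx
    rw [hx0, norm_zero] at hle
    exact norm_le_zero_iff.mp (nonpos_of_mul_nonpos_right hle (abs_pos.mpr hz))

lemma mem_map_sub_of_eigenvector (hL : IsAdjointOn T L T L) (hz : z.im ≠ 0) {X : Submodule ℂ H}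
    {x : H} (hxL : x ∈ L) (hxX : x ∈ X) (hx : ∃ μ : ℂ, T x = μ • x) :
    x ∈ X.map (T - z • 1) := by
  obtain ⟨μ, hμ⟩ := hx
  have hshift : (T - z • 1) x = (μ - z) • x := by
    rw [sub_smul, ← hμ]
    rfl
  rcases eq_or_ne μ z with rfl | hne
  · rw [sub_self, zero_smul] at hshift
    rw [LinearMap.disjoint_ker.mp (hL.disjoint_ker_sub hz) x hxL hshift]
    exact zero_mem _
  · refine ⟨(μ - z)⁻¹ • x, X.smul_mem _ hxX, ?_⟩
    rw [map_smul, hshift, inv_smul_smul₀ (sub_ne_zero.mpr hne)]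

variable [CompleteSpace H]

lemma map_sub_eq_top (hL : IsAdjointOn T L T L) (hz : z.im ≠ 0) : L.map (T - z • 1) = ⊤ := by
  have hadj := hL.sub_smul_one (conj z)
  rw [Complex.conj_conj] at hadj
  refine hadj.map_eq_top (abs_pos.mpr (im_conj_ne_zero hz)) fun x hx =>
    hL.abs_im_mul_norm_le (conj z) hx

end IsAdjointOn

/-- `L` is the domain of a self-adjoint operator between a minimal operator with domain `V` and its
adjoint, the maximal operator, with domain `W`; all three are restrictions of one everywhere defined
map `T`. The field `isAdjointOn_max` encodes the closedness of the minimal operator. -/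
structure IsSelfAdjointExtension (T : Module.End ℂ H) (V L W : Submodule ℂ H) : Prop where
  min_le : V ≤ L
  isAdjointOn_min : IsAdjointOn T V T W
  isAdjointOn_max : IsAdjointOn T W T V
  isAdjointOn_self : IsAdjointOn T L T L

lemma IsAdjointOn.isSelfAdjointExtension (hL : IsAdjointOn T L T L) :
    IsSelfAdjointExtension T L L L :=
  ⟨le_rfl, hL, hL, hL⟩

namespace IsSelfAdjointExtension

lemma le_max (h : IsSelfAdjointExtension T V L W) : L ≤ W := fun x hx =>
  ((h.isAdjointOn_min x (T x)).mp fun _ hy => h.isAdjointOn_self.inner_eq hx (h.min_le hy)).1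

variable [CompleteSpace H]

lemma sup_inf_ker_sub_eq (h : IsSelfAdjointExtension T V L W) (hz : z.im ≠ 0) :
    L ⊔ W ⊓ (T - z • 1).ker = W := by
  have hmap : W ≤ L ⊔ (T - z • 1).ker := (LinearMap.map_le_map_iff _).mp <|
    (h.isAdjointOn_self.map_sub_eq_top hz).symm ▸ le_top
  rw [inf_comm, ← sup_inf_assoc_of_le _ h.le_max, inf_eq_right.mpr hmap]

lemma mem_min_iff (h : IsSelfAdjointExtension T V L W) (hz : z.im ≠ 0) {x : H} (hx : x ∈ L) :
    x ∈ V ↔ (T - z • 1) x ∈ (W ⊓ (T - conj z • 1).ker)ᗮ := by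
  rw [Submodule.mem_orthogonal']
  refine ⟨fun hxV e ⟨heW, he⟩ => ?_, fun hxe => ?_⟩
  · have hadj := (h.isAdjointOn_max.sub_smul_one (conj z)).inner_eq hxV heW
    rw [Complex.conj_conj, LinearMap.mem_ker.mp he, inner_zero_right] at hadj
    exact hadj.symm
  · have hker : W ⊓ (T - conj z • 1).ker ≤ (innerₛₗ ℂ x ∘ₗ T).eqLocus (innerₛₗ ℂ (T x)) :=
      fun e he => by
        have hTe : T e = conj z • e := sub_eq_zero.mp he.2
        have hTx : ⟪T x - z • x, e⟫_ℂ = 0 := hxe e he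
        rw [inner_sub_left, inner_smul_left, sub_eq_zero] at hTx
        change ⟪x, T e⟫_ℂ = ⟪T x, e⟫_ℂ
        rw [hTe, inner_smul_right, hTx]
    have hle : W ≤ (innerₛₗ ℂ x ∘ₗ T).eqLocus (innerₛₗ ℂ (T x)) := by
      rw [← h.sup_inf_ker_sub_eq (im_conj_ne_zero hz)]
      exact sup_le (fun y hy => h.isAdjointOn_self.inner_eq hx hy) hker
    exact ((h.isAdjointOn_max x (T x)).mp hle).1

lemma orthogonal_le_map_min (h : IsSelfAdjointExtension T V L W) (hz : z.im ≠ 0) :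
    (W ⊓ (T - conj z • 1).ker)ᗮ ≤ V.map (T - z • 1) := fun u hu => by
  obtain ⟨x, hx, rfl⟩ : u ∈ L.map (T - z • 1) :=
    (h.isAdjointOn_self.map_sub_eq_top hz).symm ▸ Submodule.mem_top
  exact ⟨x, (h.mem_min_iff hz hx).mpr hu, rfl⟩

lemma map_max_eq_top (h : IsSelfAdjointExtension T V L W) (hz : z.im ≠ 0) :
    W.map (T - z • 1) = ⊤ :=
  top_le_iff.mp ((h.isAdjointOn_self.map_sub_eq_top hz).symm.trans_le (Submodule.map_mono h.le_max))

lemma rank_inf_ker_sub_eq (h : IsSelfAdjointExtension T V L W) (hz : z.im ≠ 0) :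
    Module.rank ℂ ↥(W ⊓ (T - z • 1).ker) = Module.rank ℂ (W.map L.mkQ) := by
  have hdisj : Disjoint L (W ⊓ (T - z • 1).ker) :=
    (h.isAdjointOn_self.disjoint_ker_sub hz).mono_right inf_le_right
  rw [← rank_map_mkQ_sup_of_disjoint hdisj, h.sup_inf_ker_sub_eq hz]

variable [FiniteDimensional ℂ (W.map L.mkQ)]

lemma finiteDimensional_inf_ker_sub (h : IsSelfAdjointExtension T V L W) (hz : z.im ≠ 0) :
    FiniteDimensional ℂ ↥(W ⊓ (T - z • 1).ker) :=
  Module.rank_lt_aleph0_iff.mp <| (h.rank_inf_ker_sub_eq hz).trans_lt (Module.rank_lt_aleph0 ℂ _)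

lemma rank_map_mkQ_eq (h : IsSelfAdjointExtension T V L W) :
    Module.rank ℂ (L.map V.mkQ) = Module.rank ℂ (W.map L.mkQ) := by
  have hconj := im_conj_ne_zero im_I_ne_zero
  let K := W ⊓ (T - conj Complex.I • 1).ker
  have : FiniteDimensional ℂ K := h.finiteDimensional_inf_ker_sub hconj
  let p : H →ₗ[ℂ] K := K.orthogonalProjectionOnto.toLinearMap ∘ₗ (T - Complex.I • 1)
  have hker : L ⊓ V.mkQ.ker = L ⊓ p.ker := by
    ext x
    rw [Submodule.ker_mkQ]
    exact and_congr_right fun hx => (h.mem_min_iff im_I_ne_zero hx).trans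
      Submodule.orthogonalProjectionOnto_eq_zero_iff.symm
  have hmap : L.map p = ⊤ := by
    rw [Submodule.map_comp, h.isAdjointOn_self.map_sub_eq_top im_I_ne_zero, Submodule.map_top]
    exact LinearMap.range_eq_top.mpr fun k =>
      ⟨k, K.orthogonalProjectionOnto_mem_subspace_eq_self k⟩
  rw [rank_map_eq_of_inf_ker_eq hker, hmap, rank_top, h.rank_inf_ker_sub_eq hconj]

end IsSelfAdjointExtension

/-- For every nonreal `z`, the range of `T - z` on `V` is the orthogonal complement of a
finite-dimensional space, namely of the defect space of `T` on `W`; here `W` is meant to be the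
domain of the adjoint. -/
def HasFiniteCodimRanges (T : Module.End ℂ H) (V W : Submodule ℂ H) : Prop :=
  ∀ z : ℂ, z.im ≠ 0 → FiniteDimensional ℂ ↥(W ⊓ (T - conj z • 1).ker) ∧
    (W ⊓ (T - conj z • 1).ker)ᗮ ≤ V.map (T - z • 1)

lemma isAdjointOn_one_top : IsAdjointOn (1 : Module.End ℂ H) ⊤ 1 ⊤ := fun φ g => by
  simp only [Submodule.mem_top, true_and, forall_const, Module.End.one_apply]
  exact ⟨ext_inner_right ℂ, fun h _ => h ▸ rfl⟩

lemma exists_multiset_prod_X_sub_C_eq {n : ℕ} (hn : n ≠ 0) (hz : z.im ≠ 0) :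
    ∃ s : Multiset ℂ, s.card = n ∧ (∀ ζ ∈ s, ζ.im ≠ 0) ∧
      (s.map (X - C ·)).prod = X ^ n - C z := by
  have hprod := (IsAlgClosed.splits (X ^ n - C z)).eq_prod_roots_of_monic (monic_X_pow_sub_C z hn)
  refine ⟨(X ^ n - C z).roots, ?_, fun ζ hζ hreal => hz ?_, hprod.symm⟩
  · rw [← natDegree_multiset_prod_X_sub_C_eq_card, ← hprod, natDegree_X_pow_sub_C]
  · have hroot : ζ ^ n = z := by
      simpa only [IsRoot, eval_sub, eval_pow, eval_X, eval_C, sub_eq_zero] using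
        isRoot_of_mem_roots hζ
    rw [← hroot, ← Complex.conj_eq_iff_im, map_pow, Complex.conj_eq_iff_im.mpr hreal]

theorem IsAdjointOn.aeval_multiset_prod (h : IsAdjointOn T V T W)
    (hV : HasFiniteCodimRanges T V W) (hW : HasFiniteCodimRanges T W V) {s : Multiset ℂ}
    (hs : ∀ z ∈ s, z.im ≠ 0) :
    IsAdjointOn (aeval T (s.map (X - C ·)).prod) (powDom T V s.card)
      (aeval T ((s.map (X - C ·)).prod.map (starRingEnd ℂ))) (powDom T W s.card) := by
  induction s using Multiset.induction with
  | empty =>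
    simpa only [Multiset.map_zero, Multiset.prod_zero, Polynomial.map_one, map_one,
      Multiset.card_zero, powDom_zero] using isAdjointOn_one_top
  | cons z s ih =>
    obtain ⟨hz, hs⟩ := Multiset.forall_mem_cons.mp hs
    set q := (s.map (X - C ·)).prod with hq
    have hmonic : (q.map (starRingEnd ℂ)).Monic := (monic_multisetProd_X_sub_C s).map _
    have hdeg : (q.map (starRingEnd ℂ)).natDegree = s.card := by
      rw [natDegree_map, hq, natDegree_multiset_prod_X_sub_C_eq_card]
    have hWdom := powDom_natDegree_succ T W hmonic
    rw [hdeg] at hWdom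
    have := (hV z hz).1
    have hrange' := (hW (conj z) (im_conj_ne_zero hz)).2
    rw [Complex.conj_conj] at hrange'
    rw [Multiset.map_cons, Multiset.prod_cons, ← hq, Polynomial.map_mul, Polynomial.map_sub, map_X,
      map_C, map_mul (aeval T) (X - C _) (q.map _), mul_comm, map_mul, aeval_X_sub_C_eq,
      aeval_X_sub_C_eq, Multiset.card_cons, hWdom, powDom_succ_eq_inf_comap_sub T V _ z]
    exact (h.sub_smul_one z).comp (ih hs) (hV z hz).2 hrange'

lemma IsAdjointOn.pow (h : IsAdjointOn T V T W) (hV : HasFiniteCodimRanges T V W)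
    (hW : HasFiniteCodimRanges T W V) {n : ℕ} (hn : n ≠ 0) :
    IsAdjointOn (T ^ n) (powDom T V n) (T ^ n) (powDom T W n) := by
  obtain ⟨s, rfl, hs, hprod⟩ := exists_multiset_prod_X_sub_C_eq hn im_I_ne_zero
  have hadj := (h.aeval_multiset_prod hV hW hs).sub_smul_one (-Complex.I)
  simpa only [hprod, Polynomial.map_sub, Polynomial.map_pow, map_X, map_C, map_sub, map_pow,
    aeval_X, aeval_C, Algebra.algebraMap_eq_smul_one, map_neg, neg_smul, sub_neg_eq_add,
    sub_add_cancel] using hadj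

namespace IsSelfAdjointExtension

variable [CompleteSpace H]

lemma hasFiniteCodimRanges_max (h : IsSelfAdjointExtension T V L W) :
    HasFiniteCodimRanges T W V := fun z hz => by
  have hbot : V ⊓ (T - conj z • 1).ker = ⊥ :=
    ((h.isAdjointOn_self.disjoint_ker_sub (im_conj_ne_zero hz)).mono_left h.min_le).eq_bot
  rw [hbot, h.map_max_eq_top hz]
  exact ⟨inferInstance, le_top⟩

lemma rank_powDom_inf_ker_pow_sub (h : IsSelfAdjointExtension T V L W) {n : ℕ} (hn : n ≠ 0)
    (hz : z.im ≠ 0) :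
    Module.rank ℂ ↥(powDom T W n ⊓ (T ^ n - z • 1).ker) = n * Module.rank ℂ (W.map L.mkQ) := by
  obtain ⟨s, rfl, hs, hprod⟩ := exists_multiset_prod_X_sub_C_eq hn hz
  have hrank := rank_powDom_inf_ker_aeval T s (fun ζ hζ => h.map_max_eq_top (hs ζ hζ))
    fun ζ hζ => h.rank_inf_ker_sub_eq (hs ζ hζ)
  rwa [hprod, map_sub, map_pow, aeval_X, aeval_C, Algebra.algebraMap_eq_smul_one] at hrank

variable [FiniteDimensional ℂ (W.map L.mkQ)]

lemma hasFiniteCodimRanges_min (h : IsSelfAdjointExtension T V L W) :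
    HasFiniteCodimRanges T V W := fun _ hz =>
  ⟨h.finiteDimensional_inf_ker_sub (im_conj_ne_zero hz), h.orthogonal_le_map_min hz⟩

theorem pow (h : IsSelfAdjointExtension T V L W) {n : ℕ} (hn : n ≠ 0) :
    IsSelfAdjointExtension (T ^ n) (powDom T V n) (powDom T L n) (powDom T W n) where
  min_le := powDom_mono T h.min_le n
  isAdjointOn_min := h.isAdjointOn_min.pow h.hasFiniteCodimRanges_min h.hasFiniteCodimRanges_max hn
  isAdjointOn_max := h.isAdjointOn_max.pow h.hasFiniteCodimRanges_max h.hasFiniteCodimRanges_min hn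
  isAdjointOn_self :=
    have hself := h.isAdjointOn_self.isSelfAdjointExtension.hasFiniteCodimRanges_max
    h.isAdjointOn_self.pow hself hself hn

end IsSelfAdjointExtension

lemma eq_top_of_dense_of_orthogonal_le {K X : Submodule ℂ H} [FiniteDimensional ℂ K]
    (hX : Dense (X : Set H)) (h : Kᗮ ≤ X) : X = ⊤ := by
  have : FiniteDimensional ℂ (H ⧸ Kᗮ) :=
    (Submodule.quotientEquivOfIsCompl _ _ K.isCompl_orthogonal.symm).symm.finiteDimensional
  have hclosed : IsClosed (X : Set H) :=
    Submodule.isClosed_mono_of_finiteDimensional_quotient K.isClosed_orthogonal h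
  rw [← hclosed.submodule_topologicalClosure_eq,
    Submodule.dense_iff_topologicalClosure_eq_top.mp hX]

lemma linIndepModulo_iff {N : ℕ} {w : Fin N → H} :
    LinIndepModulo V w ↔ LinearIndependent ℂ (V.mkQ ∘ w) := by
  rw [Fintype.linearIndependent_iff]
  refine forall_congr' fun α => imp_congr_left ?_
  rw [← Submodule.Quotient.mk_eq_zero, ← V.mkQ_apply, map_sum]
  simp only [map_smul, Function.comp_apply]

namespace IsSelfAdjointExtension

variable [CompleteSpace H]

lemma sup_span_eq (h : IsSelfAdjointExtension T V L W) [FiniteDimensional ℂ (W.map L.mkQ)]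
    {ι : Type*} {P : ι → H} (hPL : ∀ k, P k ∈ L) (heig : ∀ k, ∃ μ : ℂ, T (P k) = μ • P k)
    (hP : Dense (Submodule.span ℂ (Set.range P) : Set H)) :
    V ⊔ Submodule.span ℂ (Set.range P) = L := by
  have hspan : Submodule.span ℂ (Set.range P) ≤ L :=
    Submodule.span_le.mpr (Set.range_subset_iff.mpr hPL)
  have hle : V ⊔ Submodule.span ℂ (Set.range P) ≤ L := sup_le h.min_le hspan
  have hPmap (k : ι) : P k ∈ (Submodule.span ℂ (Set.range P)).map (T - Complex.I • 1) :=
    h.isAdjointOn_self.mem_map_sub_of_eigenvector im_I_ne_zero (hPL k)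
      (Submodule.subset_span (Set.mem_range_self k)) (heig k)
  have := h.finiteDimensional_inf_ker_sub (im_conj_ne_zero im_I_ne_zero)
  have htop : (V ⊔ Submodule.span ℂ (Set.range P)).map (T - Complex.I • 1) = ⊤ := by
    refine eq_top_of_dense_of_orthogonal_le (hP.mono ?_)
      ((h.orthogonal_le_map_min im_I_ne_zero).trans (Submodule.map_mono le_sup_left))
    exact (Submodule.span_le.mpr (Set.range_subset_iff.mpr hPmap)).trans
      (Submodule.map_mono le_sup_right)
  exact eq_of_map_le_of_disjoint_ker hle (h.isAdjointOn_self.disjoint_ker_sub im_I_ne_zero)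
    (htop ▸ le_top)

lemma boundaryForm_toPMap (h : IsSelfAdjointExtension T V L W)
    (f g : (T.toPMap V).adjoint.domain) :
    boundaryForm (T.toPMap V).adjoint f g = ⟪(g : H), T f⟫_ℂ - ⟪T g, (f : H)⟫_ℂ := by
  revert f g
  rw [(isAdjointOn_iff.mp h.isAdjointOn_min).2]
  exact fun _ _ => rfl

lemma isGKNConditions (h : IsSelfAdjointExtension T V L W) {N : ℕ} {w : Fin N → H}
    (hindep : LinearIndependent ℂ (V.mkQ ∘ w))
    (hspan : V ⊔ Submodule.span ℂ (Set.range w) = L) :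
    IsGKNConditions (T.toPMap V) L w := by
  have hw (k : Fin N) : w k ∈ L :=
    hspan ▸ Submodule.mem_sup_right (Submodule.subset_span (Set.mem_range_self k))
  have hdom : (T.toPMap V).adjoint.domain = W :=
    congrArg LinearPMap.domain (isAdjointOn_iff.mp h.isAdjointOn_min).2
  have hzero {f g : H} (hf : f ∈ L) (hg : g ∈ L) : ⟪g, T f⟫_ℂ - ⟪T g, f⟫_ℂ = 0 :=
    sub_eq_zero.mpr (h.isAdjointOn_self.inner_eq hg hf)
  refine ⟨fun k => hdom ▸ h.le_max (hw k), linIndepModulo_iff.mpr hindep,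
    fun j k => (h.boundaryForm_toPMap _ _).trans (hzero (hw j) (hw k)), fun f =>
    ⟨fun hf => ⟨hdom ▸ h.le_max hf, fun k => (h.boundaryForm_toPMap _ _).trans (hzero hf (hw k))⟩,
      fun ⟨hf, hfw⟩ => ?_⟩⟩
  have hle : L ≤ (innerₛₗ ℂ f ∘ₗ T).eqLocus (innerₛₗ ℂ (T f)) := by
    rw [← hspan, sup_le_iff, Submodule.span_le, Set.range_subset_iff]
    refine ⟨fun y hy => h.isAdjointOn_min.inner_eq (hdom ▸ hf) hy, fun k => ?_⟩
    have hk : ⟪w k, T f⟫_ℂ = ⟪T (w k), f⟫_ℂ :=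
      sub_eq_zero.mp ((h.boundaryForm_toPMap _ _).symm.trans (hfw k))
    change ⟪f, T (w k)⟫_ℂ = ⟪T f, w k⟫_ℂ
    rw [← inner_conj_symm, ← hk, inner_conj_symm]
  exact ((h.isAdjointOn_self f (T f)).mp hle).1

theorem exists_isGKNConditions (h : IsSelfAdjointExtension T V L W) {N : ℕ}
    (hN : Module.rank ℂ (W.map L.mkQ) = N) {ι : Type*} {P : ι → H} (hPL : ∀ k, P k ∈ L)
    (heig : ∀ k, ∃ μ : ℂ, T (P k) = μ • P k)
    (hP : Dense (Submodule.span ℂ (Set.range P) : Set H)) :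
    ∃ κ : Fin N → ι, Function.Injective κ ∧ IsGKNConditions (T.toPMap V) L (P ∘ κ) := by
  have : FiniteDimensional ℂ (W.map L.mkQ) :=
    Module.rank_lt_aleph0_iff.mp (hN ▸ Cardinal.natCast_lt_aleph0)
  have hsup := h.sup_span_eq hPL heig hP
  obtain ⟨κ, hκ, hindep, hspan⟩ := exists_fin_linearIndependent_mkQ (V := V) (P := P) <| by
    rw [hsup, h.rank_map_mkQ_eq, hN]
  exact ⟨κ, hκ, h.isGKNConditions hindep (hspan.trans hsup)⟩

lemma isClosedSymmetric (h : IsSelfAdjointExtension T V L W) :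
    IsClosedSymmetric (T.toPMap V) where
  dense := h.isAdjointOn_min.dense
  symmetric x y := (h.isAdjointOn_self.inner_eq (h.min_le x.2) (h.min_le y.2)).symm
  closed := by
    rw [← (isAdjointOn_iff.mp h.isAdjointOn_max).2]
    exact LinearPMap.adjoint_isClosed h.isAdjointOn_max.dense

end IsSelfAdjointExtension

theorem exists_isSelfAdjointExtension [CompleteSpace H] {A B : H →ₗ.[ℂ] H}
    (hdense : Dense (A.domain : Set H)) (hclosed : A.IsClosed) (hB : IsSelfAdjoint B)
    (hAB : A ≤ B) :
    ∃ (T : Module.End ℂ H) (V L W : Submodule ℂ H), A = T.toPMap V ∧ B = T.toPMap L ∧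
      IsSelfAdjointExtension T V L W := by
  obtain ⟨T, hT⟩ := exists_eq_toPMap A.adjoint
  have hBsymm : B.IsFormalAdjoint B := by
    simpa only [LinearPMap.isSelfAdjoint_def.mp hB] using
      LinearPMap.adjoint_isFormalAdjoint hB.dense_domain
  have hBmax : B ≤ T.toPMap A.adjoint.domain := hT ▸
    LinearPMap.IsFormalAdjoint.le_adjoint hdense fun x y => by
      rw [hAB.2 (x := x) (y := ⟨x, hAB.1 x.2⟩) rfl]
      exact hBsymm _ y
  have hAT := eq_toPMap_of_le (hAB.trans hBmax)
  have hBT := eq_toPMap_of_le hBmax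
  have hmin : IsAdjointOn T A.domain T A.adjoint.domain :=
    isAdjointOn_iff.mpr ⟨hdense, by rw [← hAT, ← hT]⟩
  have hself : IsAdjointOn T B.domain T B.domain :=
    isAdjointOn_iff.mpr ⟨hB.dense_domain, by rw [← hBT, LinearPMap.isSelfAdjoint_def.mp hB]⟩
  exact ⟨T, A.domain, B.domain, A.adjoint.domain, hAT, hBT, hAB.1, hmin,
    hmin.symm_of_isClosed (hAT ▸ hclosed), hself⟩

end SelfAdjointExtension

end LeftDefinite

open LeftDefinite in
theorem theorem5p2_general {H ι : Type*} [NormedAddCommGroup H] [InnerProductSpace ℂ H]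
    [CompleteSpace H] {Lmin L : H →ₗ.[ℂ] H} {m n : ℕ} (hn : n ≠ 0)
    (hdense : Dense (Lmin.domain : Set H)) (hclosed : Lmin.IsClosed)
    (hdef : Module.rank ℂ (defectSpace Lmin Complex.I) = m) (hL : IsSelfAdjoint L)
    (hext : Lmin ≤ L) {P : ι → H}
    (hP : ∀ k, ∃ (h : P k ∈ L.domain) (μ : ℂ), L ⟨P k, h⟩ = μ • P k)
    (hPdense : Dense (Submodule.span ℂ (Set.range P) : Set H)) :
    (IsClosedSymmetric (opPow Lmin n) ∧ (opPow Lmin n).adjoint = opPow Lmin.adjoint n ∧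
      IsSelfAdjoint (opPow L n) ∧ opPow Lmin n ≤ opPow L n) ∧
    HasDeficiencyIndices (opPow Lmin n) (n * m) (n * m) ∧
    (∀ c : ℝ, evenLeftDefiniteSpace (opShift L c) n = (opPow L n).domain) ∧
    ∃ κ : Fin (n * m) → ι, Function.Injective κ ∧
      IsGKNConditions (opPow Lmin n) (opPow L n).domain (fun i => P (κ i)) := by
  obtain ⟨T, V, D, W, rfl, rfl, h⟩ := exists_isSelfAdjointExtension hdense hclosed hL hext
  rw [defectSpace_toPMap h.isAdjointOn_min, h.rank_inf_ker_sub_eq im_I_ne_zero] at hdef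
  have : FiniteDimensional ℂ (W.map D.mkQ) :=
    Module.rank_lt_aleph0_iff.mp (hdef ▸ Cardinal.natCast_lt_aleph0)
  have hpow := h.pow hn
  have hrank (z : ℂ) (hz : z.im ≠ 0) :
      Module.rank ℂ ↥(powDom T W n ⊓ (T ^ n - z • 1).ker) = (n * m : ℕ) := by
    rw [h.rank_powDom_inf_ker_pow_sub hn hz, hdef, Nat.cast_mul]
  have hquot := (hpow.rank_inf_ker_sub_eq im_I_ne_zero).symm.trans (hrank _ im_I_ne_zero)
  choose hPD μ hμ using hP
  have hPpow (k : ι) (j : ℕ) : (T ^ j) (P k) = μ k ^ j • P k := pow_apply_eq_pow_smul T (hμ k) j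
  simp only [(isAdjointOn_iff.mp h.isAdjointOn_min).2, opShift_toPMap, opPow_toPMap,
    evenLeftDefiniteSpace]
  refine ⟨⟨hpow.isClosedSymmetric, (isAdjointOn_iff.mp hpow.isAdjointOn_min).2,
    LinearPMap.isSelfAdjoint_def.mpr (isAdjointOn_iff.mp hpow.isAdjointOn_self).2,
    toPMap_mono _ hpow.min_le⟩, ⟨?_, ?_⟩, fun c => powDom_sub_smul_one T D n _,
    hpow.exists_isGKNConditions hquot (fun k j _ => ?_) (fun k => ⟨_, hPpow k n⟩) hPdense⟩
  · rw [defectSpace_toPMap hpow.isAdjointOn_min, hrank _ im_I_ne_zero]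
  · rw [defectSpace_toPMap hpow.isAdjointOn_min, hrank _ (by norm_num)]
  · exact hPpow k j ▸ D.smul_mem _ (hPD k)

theorem theorem5p2 {H : Type*} [NormedAddCommGroup H] [InnerProductSpace ℂ H] [CompleteSpace H]
    (Lmin L : H →ₗ.[ℂ] H) (m n : ℕ) (hn : 1 ≤ n)
    (hmin : LeftDefinite.IsClosedSymmetric Lmin)
    (hdef : LeftDefinite.HasDeficiencyIndices Lmin m m)
    (hL : IsSelfAdjoint L) (hext : Lmin ≤ L)
    (hbdd : ∃ k : ℝ, LeftDefinite.IsBoundedBelowBy L k)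
    (P : ℕ → H) (hP : LeftDefinite.IsCompleteOrthogonalEigensystem L P) :
    -- the `n`-th power of the minimal operator is again such a minimal operator, the associated
    -- maximal operator is the `n`-th power of the maximal one, and `L ^ n` is a self-adjoint
    -- extension
    (LeftDefinite.IsClosedSymmetric (LeftDefinite.opPow Lmin n) ∧
      (LeftDefinite.opPow Lmin n).adjoint = LeftDefinite.opPow Lmin.adjoint n ∧
      IsSelfAdjoint (LeftDefinite.opPow L n) ∧
      LeftDefinite.opPow Lmin n ≤ LeftDefinite.opPow L n) ∧
    -- the deficiency indices
    LeftDefinite.HasDeficiencyIndices (LeftDefinite.opPow Lmin n) (n * m) (n * m) ∧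
    -- the GKN conditions for `D(L ^ n)`, which is the `2n`-th left-definite space of `L`, for
    -- every admissible shift of `L`
    (∀ c k : ℝ, 0 < k → LeftDefinite.IsBoundedBelowBy (LeftDefinite.opShift L c) k →
      LeftDefinite.evenLeftDefiniteSpace (LeftDefinite.opShift L c) n =
        (LeftDefinite.opPow L n).domain) ∧
    ∃ κ : Fin (n * m) → ℕ, Function.Injective κ ∧
      LeftDefinite.IsGKNConditions (LeftDefinite.opPow Lmin n) (LeftDefinite.opPow L n).domain
        (fun i => P (κ i)) := by
  obtain ⟨hpow, hindices, hshift, hGKN⟩ := theorem5p2_general (Nat.one_le_iff_ne_zero.mp hn)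
    hmin.dense hmin.closed hdef.1 hL hext hP.eigen hP.complete
  exact ⟨hpow, hindices, fun c _ _ _ => hshift c, hGKN⟩
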